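/- Let $0<s<1$. For $k\in\mathbb Z$ let $$I_k(t)=\sum_{n=0}^\infty \frac{1}{n!\,\Gamma(n+k+1)}\Big(\frac t2\Big)^{2n+k}$$ be the modified Bessel function of the first kind (with $1/\Gamma=0$ at nonpositive integers), and for $m=(m_1,m_2)\in\mathbb Z^2$ and $t>0$ let $G(m,t)=e^{-4t}I_{m_1}(2t)I_{m_2}(2t)$ be the two-dimensional semidiscrete heat kernel. Let $K_s$ be the kernel of the fractional discrete Laplacian in dimension two, that is, $K_s(0)=0$ and $$K_s(m)=\frac{1}{|\Gamma(-s)|}\int_0^\infty G(m,t)\,\frac{dt}{t^{1+s}},\qquad m\in\mathbb Z^2\setminus\{0\}.$$ Then for every $m\in\mathbb Z^2\setminus\{0\}$ this integral converges absolutely and $K_s(m)>0$. Moreover, with $\|m\|_2=(m_1^2+m_2^2)^{1/2}$ and $$c_{2,s}=\frac{4^s\,\Gamma(1+s)}{\pi\,|\Gamma(-s)|},$$ one has $$K_s(m)=\frac{c_{2,s}}{\|m\|_2^{2+2s}}+o\!\left(\frac{1}{\|m\|_2^{2+2s}}\right)\qquad\text{as } |m_1|\to\infty \text{ and } |m_2|\to\infty,$$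 where the two coordinates tend to $\pm\infty$ jointly, independently of each other and with arbitrary signs. -/

import Mathlib

open Filter Asymptotics

noncomputable section

namespace DiscreteFractional

/-- The modified Bessel function of the first kind of integer order `k`,
`I_k(t) = ∑_{n ≥ 0} 1 / (n! Γ(n + k + 1)) (t/2)^(2n + k)`, where `1/Γ` is zero at the
nonpositive integers. (Mathlib's `Real.Gamma` vanishes there, and `0⁻¹ = 0`, so the convention
on `1/Γ` holds; in particular no negative power of `t` carries a nonzero coefficient.) -/
def besselI (k : ℤ) (t : ℝ) : ℝ :=
  ∑' n : ℕ, ((n.factorial : ℝ) * Real.Gamma ((n : ℝ) + (k : ℝ) + 1))⁻¹ *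
    (t / 2) ^ (2 * (n : ℤ) + k)

/-- The one-dimensional semidiscrete heat kernel `e^{-2t} I_k(2t)`. -/
def heatKernel₁ (k : ℤ) (t : ℝ) : ℝ :=
  Real.exp (-2 * t) * besselI k (2 * t)

/-- The two-dimensional semidiscrete heat kernel
`G(m, t) = e^{-4t} I_{m₁}(2t) I_{m₂}(2t)`, the product of the one-dimensional ones. -/
def heatKernel₂ (m : ℤ × ℤ) (t : ℝ) : ℝ :=
  heatKernel₁ m.1 t * heatKernel₁ m.2 t

/-- The kernel of the two-dimensional fractional discrete Laplacian of order `s`: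
`K_s(m) = |Γ(-s)|⁻¹ ∫_0^∞ G(m, t) t^{-1-s} dt` for `m ≠ 0`, and `K_s(0) = 0`. -/
def fracKernel (s : ℝ) (m : ℤ × ℤ) : ℝ :=
  if m = 0 then 0
  else 1 / |Real.Gamma (-s)| * ∫ t in Set.Ioi (0 : ℝ), heatKernel₂ m t / t ^ (1 + s)

/-- The Euclidean norm on `ℤ²`. -/
def euclNorm (m : ℤ × ℤ) : ℝ :=
  Real.sqrt ((m.1 : ℝ) ^ 2 + (m.2 : ℝ) ^ 2)

/-- The constant `c_{2,s} = 4^s Γ(1+s) / (π |Γ(-s)|)`. -/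
def fracConst (s : ℝ) : ℝ :=
  4 ^ s * Real.Gamma (1 + s) / (Real.pi * |Real.Gamma (-s)|)

/-- Both coordinates of `m ∈ ℤ²` tend to infinity in absolute value, jointly,
independently of each other and with arbitrary signs: `m₁ → ±∞` and `m₂ → ±∞`. -/
def bothToInfinity : Filter (ℤ × ℤ) :=
  (atBot ⊔ atTop) ×ˢ (atBot ⊔ atTop)

end DiscreteFractional

end

/-! With N = ‖m‖₂, the substitution t = N²u turns K_s(m)·N^(2+2s) into |Γ(-s)|⁻¹ times the integral
of N² G(m, N²u) u^(-1-s) over u > 0. For fixed u, the local limit theorem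
`abs_mul_heatKernel₁_sub_le` makes each factor N·e^(-2t) I_k(2t) close to a Gaussian in k/N,
uniformly in k. The product of the two Gaussians depends on m only through m₁² + m₂² = N², so the
limit (4πu)⁻¹ e^(-1/(4u)) is the same in every direction. Its integral against u^(-1-s) is a Gamma
integral, which yields c_{2,s}.

Dominated convergence needs a bound uniform in m: `heatKernel₂_scaled_le` gives 4096·min(u, 1/u),
integrable against u^(-1-s) for 0 < s < 1. The part 1/u is the on-diagonal decay t^(-1/2) in each
coordinate. The part u is off-diagonal decay (`pow_four_mul_heatKernel₁_le`), obtained from the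
Bessel recurrence by telescoping. All this works as ‖m‖₂ → ∞ in any manner, which the joint limit of
the coordinates implies. -/

namespace DiscreteFractional

open MeasureTheory

open scoped Nat Topology

/-! ### Fourier integral for the one-dimensional heat kernel. -/

section FourierRepresentation

lemma integral_cos_int_mul (n : ℤ) :
    ∫ θ in (-Real.pi)..Real.pi, Real.cos (n * θ) = if n = 0 then 2 * Real.pi else 0 := by
  split_ifs with h
  · subst h
    simp only [Int.cast_zero, zero_mul, Real.cos_zero, intervalIntegral.integral_const]
    rw [smul_eq_mul]; ring
  · have hn : (n : ℝ) ≠ 0 := by exact_mod_cast h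
    rw [intervalIntegral.integral_comp_mul_left (fun x => Real.cos x) hn, integral_cos]
    simp [Real.sin_int_mul_pi]

lemma re_term_mul_exp (k : ℤ) (t θ : ℝ) (m n : ℕ) :
    ((t * Complex.exp (-(θ * Complex.I))) ^ m / (m ! : ℂ) *
        ((t * Complex.exp (θ * Complex.I)) ^ n / (n ! : ℂ)) *
        Complex.exp (-(k * θ * Complex.I))).re =
      t ^ m / m ! * (t ^ n / n !) * Real.cos (((n - m - k : ℤ) : ℝ) * θ) := by
  have e : Complex.exp (((((n - m - k : ℤ) : ℝ) * θ : ℝ) : ℂ) * Complex.I) =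
      Complex.exp (-(θ * Complex.I)) ^ m * Complex.exp (θ * Complex.I) ^ n *
        Complex.exp (-(k * θ * Complex.I)) := by
    rw [← Complex.exp_nat_mul, ← Complex.exp_nat_mul, ← Complex.exp_add, ← Complex.exp_add]
    congr 1
    push_cast
    ring
  rw [← Complex.exp_ofReal_mul_I_re, ← Complex.re_ofReal_mul, e, mul_pow, mul_pow]
  congr 1
  push_cast
  ring

lemma re_exp_mul_exp_mul_exp (k : ℤ) (t θ : ℝ) :
    (Complex.exp (t * Complex.exp (-(θ * Complex.I))) *
        Complex.exp (t * Complex.exp (θ * Complex.I)) *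
        Complex.exp (-(k * θ * Complex.I))).re =
      Real.exp (2 * t * Real.cos θ) * Real.cos (k * θ) := by
  have e : 2 * t * Complex.cos θ =
      t * Complex.exp (-(θ * Complex.I)) + t * Complex.exp (θ * Complex.I) := by
    rw [Complex.cos, neg_mul]
    ring
  rw [← Real.cos_neg (k * θ), ← Complex.exp_ofReal_mul_I_re (-(k * θ)), ← Complex.re_ofReal_mul,
    Complex.ofReal_exp, ← Complex.exp_add]
  push_cast
  rw [e, neg_mul]

lemma hasSum_complex_exp (z : ℂ) :
    HasSum (fun n : ℕ => z ^ n / (n ! : ℂ)) (Complex.exp z) := by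
  rw [Complex.exp_eq_exp_ℂ]
  exact NormedSpace.expSeries_div_hasSum_exp z

lemma hasSum_re_exp_mul_exp (a b c : ℂ) :
    HasSum (fun p : ℕ × ℕ => (a ^ p.1 / (p.1 ! : ℂ) * (b ^ p.2 / (p.2 ! : ℂ)) * c).re)
      (Complex.exp a * Complex.exp b * c).re := by
  have hs (z : ℂ) : Summable (fun n : ℕ => ‖z ^ n / (n ! : ℂ)‖) :=
    NormedSpace.norm_expSeries_div_summable z
  have hm := (summable_mul_of_summable_norm (hs a) (hs b)).hasSum
  rw [← tsum_mul_tsum_of_summable_norm (hs a) (hs b), (hasSum_complex_exp a).tsum_eq,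
    (hasSum_complex_exp b).tsum_eq] at hm
  exact Complex.hasSum_re (hm.mul_right c)

/-- The double series of `exp (2 t cos θ) cos (k θ)`, the product of the exponential series of
`t e^{iθ}` and `t e^{-iθ}`, multiplied by `e^{-ikθ}`. -/
lemma hasSum_exp_cos (k : ℤ) (t θ : ℝ) :
    HasSum (fun p : ℕ × ℕ => t ^ p.1 / p.1 ! * (t ^ p.2 / p.2 !) *
        Real.cos (((p.2 - p.1 - k : ℤ) : ℝ) * θ))
      (Real.exp (2 * t * Real.cos θ) * Real.cos (k * θ)) := by
  rw [← re_exp_mul_exp_mul_exp]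
  simp only [← re_term_mul_exp]
  exact hasSum_re_exp_mul_exp _ _ _

/-- Termwise integration is justified by the product of two exponential series in |t|; orthogonality
of cosines keeps only the pairs with p.2 = p.1 + k. -/
lemma hasSum_besselI_aux (k : ℤ) (t : ℝ) :
    HasSum (fun p : ℕ × ℕ => t ^ p.1 / p.1 ! * (t ^ p.2 / p.2 !) *
        (if (p.2 - p.1 - k : ℤ) = 0 then 2 * Real.pi else 0))
      (∫ θ in (-Real.pi)..Real.pi, Real.exp (2 * t * Real.cos θ) * Real.cos (k * θ)) := by
  have hs : Summable (fun p : ℕ × ℕ => |t| ^ p.1 / p.1 ! * (|t| ^ p.2 / p.2 !)) := by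
    have h1 : Summable (fun n : ℕ => ‖|t| ^ n / (n ! : ℝ)‖) :=
      NormedSpace.norm_expSeries_div_summable |t|
    exact summable_mul_of_summable_norm h1 h1
  have h := intervalIntegral.hasSum_integral_of_dominated_convergence
    (μ := volume) (a := -Real.pi) (b := Real.pi)
    (F := fun (p : ℕ × ℕ) θ => t ^ p.1 / p.1 ! * (t ^ p.2 / p.2 !) *
        Real.cos (((p.2 - p.1 - k : ℤ) : ℝ) * θ))
    (f := fun θ => Real.exp (2 * t * Real.cos θ) * Real.cos (k * θ))
    (fun p _ => |t| ^ p.1 / p.1 ! * (|t| ^ p.2 / p.2 !))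
    (fun p => (Continuous.aestronglyMeasurable (by fun_prop)))
    (fun p => Eventually.of_forall fun θ _ => by
      rw [norm_mul]
      calc _ ≤ ‖t ^ p.1 / p.1 ! * (t ^ p.2 / p.2 !)‖ * 1 := by
            gcongr; exact Real.abs_cos_le_one _
        _ = _ := by simp)
    (Eventually.of_forall fun θ _ => hs)
    intervalIntegrable_const
    (Eventually.of_forall fun θ _ => hasSum_exp_cos k t θ)
  convert! h using 2 with p
  rw [intervalIntegral.integral_const_mul, integral_cos_int_mul]

lemma hasSum_besselI (k : ℤ) (t : ℝ) :
    HasSum (fun n : ℕ => ((n ! : ℝ) * Real.Gamma ((n : ℝ) + (k : ℝ) + 1))⁻¹ *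
        (2 * t / 2) ^ (2 * (n : ℤ) + k))
      ((2 * Real.pi)⁻¹ *
        ∫ θ in (-Real.pi)..Real.pi, Real.exp (2 * t * Real.cos θ) * Real.cos (k * θ)) := by
  have hpi := Real.pi_pos
  have h := ((hasSum_besselI_aux k t).mul_left (2 * Real.pi)⁻¹)
  refine h.prod_fiberwise fun n => ?_
  rw [mul_div_cancel_left₀ t two_ne_zero]
  rcases le_or_gt 0 ((n : ℤ) + k) with hk | hk
  · obtain ⟨j, hj⟩ := Int.eq_ofNat_of_zero_le hk
    have hj' : (n : ℝ) + k = j := by exact_mod_cast hj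
    have hexp : 2 * (n : ℤ) + k = ((n + j : ℕ) : ℤ) := by push_cast; omega
    rw [hj', Real.Gamma_nat_eq_factorial, hexp, zpow_natCast]
    have hval : ((n ! : ℝ) * (j ! : ℝ))⁻¹ * t ^ (n + j) = (2 * Real.pi)⁻¹ *
        (t ^ n / n ! * (t ^ j / j !) *
          (if ((j : ℤ) - n - k : ℤ) = 0 then 2 * Real.pi else 0)) := by
      rw [if_pos (by omega)]
      field_simp
      ring
    rw [hval]
    refine hasSum_single j fun b hb => ?_
    rw [if_neg (by omega)]
    simp
  -- Here n + k < 0: no natural second index matches, and the Bessel coefficient vanishes too, at a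
  -- pole of Γ.
  · obtain ⟨j, hj⟩ := Int.eq_ofNat_of_zero_le (a := -((n : ℤ) + k) - 1) (by omega)
    have hj' : (n : ℝ) + k + 1 = -(j : ℝ) := by
      have : (n : ℤ) + k + 1 = -j := by omega
      exact_mod_cast this
    rw [hj', Real.Gamma_neg_nat_eq_zero]
    simp only [mul_zero, inv_zero, zero_mul]
    have hz : ∀ b : ℕ, (2 * Real.pi)⁻¹ * (t ^ n / n ! * (t ^ b / b !) *
          (if ((b : ℤ) - n - k : ℤ) = 0 then 2 * Real.pi else 0)) = 0 := fun b => by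
      rw [if_neg (by omega)]
      simp
    simp only [hz]
    exact hasSum_zero

lemma heatKernel₁_eq_integral (k : ℤ) (t : ℝ) :
    heatKernel₁ k t = (2 * Real.pi)⁻¹ *
      ∫ θ in (-Real.pi)..Real.pi, Real.exp (-(2 * t * (1 - Real.cos θ))) * Real.cos (k * θ) := by
  rw [heatKernel₁, besselI, (hasSum_besselI k t).tsum_eq, mul_left_comm,
    ← intervalIntegral.integral_const_mul]
  congr 2
  funext θ
  rw [← mul_assoc, ← Real.exp_add]
  ring_nf

lemma heatKernel₁_neg (k : ℤ) (t : ℝ) : heatKernel₁ (-k) t = heatKernel₁ k t := by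
  simp [heatKernel₁_eq_integral]

lemma heatKernel₁_natAbs (k : ℤ) (t : ℝ) :
    heatKernel₁ (k.natAbs : ℤ) t = heatKernel₁ k t := by
  rcases Int.natAbs_eq k with h | h
  · rw [← h]
  · conv_rhs => rw [h, heatKernel₁_neg]

/-- The oscillating integral hides the sign. After reduction to a nonnegative index by symmetry, all
terms of the power series are positive. -/
lemma heatKernel₁_pos (k : ℤ) {t : ℝ} (ht : 0 < t) : 0 < heatKernel₁ k t := by
  rw [← heatKernel₁_natAbs k t]
  refine mul_pos (Real.exp_pos _) ?_
  refine (hasSum_besselI (k.natAbs : ℤ) t).summable.tsum_pos (fun n => ?_) 0 ?_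
  · have : 0 < Real.Gamma ((n : ℝ) + ((k.natAbs : ℤ) : ℝ) + 1) :=
      Real.Gamma_pos_of_pos (by positivity)
    positivity
  · have : 0 < Real.Gamma (((0 : ℕ) : ℝ) + ((k.natAbs : ℤ) : ℝ) + 1) :=
      Real.Gamma_pos_of_pos (by positivity)
    positivity

lemma continuous_heatKernel₁ (k : ℤ) : Continuous (heatKernel₁ k) := by
  have h : Continuous fun t : ℝ => (2 * Real.pi)⁻¹ *
      ∫ θ in (-Real.pi)..Real.pi,
        Real.exp (-(2 * t * (1 - Real.cos θ))) * Real.cos (k * θ) := by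
    refine continuous_const.mul ?_
    exact intervalIntegral.continuous_parametric_intervalIntegral_of_continuous'
      (by fun_prop) _ _
  rwa [funext (heatKernel₁_eq_integral k)]

end FourierRepresentation

/-! ### Bounds on the one-dimensional heat kernel, uniform in t > 0. -/

section Bounds

lemma exp_neg_one_sub_cos_le {t θ : ℝ} (ht : 0 ≤ t) (hθ : |θ| ≤ Real.pi) :
    Real.exp (-(2 * t * (1 - Real.cos θ))) ≤ Real.exp (-(4 * t / Real.pi ^ 2) * θ ^ 2) := by
  have h := Real.cos_le_one_sub_mul_cos_sq hθ
  apply Real.exp_le_exp.2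
  have : 2 * t * (2 / Real.pi ^ 2 * θ ^ 2) ≤ 2 * t * (1 - Real.cos θ) := by
    gcongr; linarith
  calc _ ≤ -(2 * t * (2 / Real.pi ^ 2 * θ ^ 2)) := by linarith
    _ = _ := by ring

lemma heatKernel₁_le_integral (k : ℤ) (t : ℝ) :
    heatKernel₁ k t ≤ (2 * Real.pi)⁻¹ *
      ∫ θ in (-Real.pi)..Real.pi, Real.exp (-(2 * t * (1 - Real.cos θ))) := by
  have hpi := Real.pi_pos
  rw [heatKernel₁_eq_integral k t]
  gcongr
  refine intervalIntegral.integral_mono_on (by linarith)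
    (Continuous.intervalIntegrable (by fun_prop) _ _)
    (Continuous.intervalIntegrable (by fun_prop) _ _) fun θ _ => ?_
  exact mul_le_of_le_one_right (Real.exp_pos _).le (Real.cos_le_one _)

lemma heatKernel₁_le_one (k : ℤ) {t : ℝ} (ht : 0 < t) : heatKernel₁ k t ≤ 1 := by
  have hpi := Real.pi_pos
  calc _ ≤ _ := heatKernel₁_le_integral k t
    _ ≤ (2 * Real.pi)⁻¹ * ∫ θ in (-Real.pi)..Real.pi, (1 : ℝ) := by
      gcongr
      refine intervalIntegral.integral_mono_on (by linarith)
        (Continuous.intervalIntegrable (by fun_prop) _ _)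
        (Continuous.intervalIntegrable (by fun_prop) _ _) fun θ _ => ?_
      apply Real.exp_le_one_iff.2
      have := Real.cos_le_one θ
      have : 0 ≤ 2 * t * (1 - Real.cos θ) := by
        apply mul_nonneg (by linarith); linarith
      linarith
    _ = 1 := by
      rw [intervalIntegral.integral_const, smul_eq_mul]
      field_simp
      ring

lemma heatKernel₁_le_inv_sqrt (k : ℤ) {t : ℝ} (ht : 0 < t) : heatKernel₁ k t ≤ (√t)⁻¹ := by
  have hpi := Real.pi_pos
  have hb : 0 < 4 * t / Real.pi ^ 2 := by positivity
  calc _ ≤ _ := heatKernel₁_le_integral k t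
    _ ≤ (2 * Real.pi)⁻¹ * ∫ θ in (-Real.pi)..Real.pi, Real.exp (-(4 * t / Real.pi ^ 2) * θ ^ 2) := by
      gcongr
      refine intervalIntegral.integral_mono_on (by linarith)
        (Continuous.intervalIntegrable (by fun_prop) _ _)
        (Continuous.intervalIntegrable (by fun_prop) _ _) fun θ hθ => ?_
      exact exp_neg_one_sub_cos_le ht.le (abs_le.2 hθ)
    _ ≤ (2 * Real.pi)⁻¹ * ∫ θ : ℝ, Real.exp (-(4 * t / Real.pi ^ 2) * θ ^ 2) := by
      gcongr
      rw [intervalIntegral.integral_of_le (by linarith)]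
      exact setIntegral_le_integral (integrable_exp_neg_mul_sq hb)
        (Eventually.of_forall fun _ => (Real.exp_pos _).le)
    _ = √Real.pi / 4 * (√t)⁻¹ := by
      rw [integral_gaussian]
      have : Real.pi / (4 * t / Real.pi ^ 2) = (Real.pi / 2) ^ 2 * (Real.pi / t) := by
        field_simp
        ring
      rw [this, Real.sqrt_mul (by positivity), Real.sqrt_sq (by positivity),
        Real.sqrt_div hpi.le]
      field_simp
      ring
    _ ≤ 1 * (√t)⁻¹ := by
      gcongr
      rw [div_le_one (by norm_num)]
      calc √Real.pi ≤ √(4 ^ 2) := Real.sqrt_le_sqrt (by linarith [Real.pi_le_four])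
        _ = 4 := Real.sqrt_sq (by norm_num)
    _ = _ := one_mul _

/-- The recurrence of the Bessel functions, for the heat kernel. -/
lemma mul_heatKernel₁ (k : ℤ) (t : ℝ) :
    k * heatKernel₁ k t = t * (heatKernel₁ (k - 1) t - heatKernel₁ (k + 1) t) := by
  have hc : ∀ j : ℤ, IntervalIntegrable (fun θ => Real.exp (-(2 * t * (1 - Real.cos θ))) *
      Real.cos (j * θ)) volume (-Real.pi) Real.pi :=
    fun j => Continuous.intervalIntegrable (by fun_prop) _ _
  -- Integration by parts: this primitive vanishes at ±π because sin(kπ) = 0, and 2 sin θ sin(kθ) =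
  -- cos((k-1)θ) - cos((k+1)θ).
  have hd : ∀ θ ∈ Set.uIcc (-Real.pi) Real.pi,
      HasDerivAt (fun θ => Real.exp (-(2 * t * (1 - Real.cos θ))) * Real.sin (k * θ))
      (k * (Real.exp (-(2 * t * (1 - Real.cos θ))) * Real.cos (k * θ)) -
        t * (Real.exp (-(2 * t * (1 - Real.cos θ))) * Real.cos ((k - 1 : ℤ) * θ) -
          Real.exp (-(2 * t * (1 - Real.cos θ))) * Real.cos ((k + 1 : ℤ) * θ))) θ := by
    intro θ _
    have h1 : HasDerivAt (fun θ : ℝ => -(2 * t * (1 - Real.cos θ)))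
        (-(2 * t * (- -Real.sin θ))) θ :=
      (((Real.hasDerivAt_cos θ).const_sub 1).const_mul (2 * t)).neg
    have h2 : HasDerivAt (fun θ : ℝ => Real.sin (k * θ)) (Real.cos (k * θ) * (k * 1)) θ :=
      ((hasDerivAt_id θ).const_mul (k : ℝ)).sin
    refine (h1.exp.mul h2).congr_deriv ?_
    have e1 : ((k - 1 : ℤ) : ℝ) * θ = k * θ - θ := by push_cast; ring
    have e2 : ((k + 1 : ℤ) : ℝ) * θ = k * θ + θ := by push_cast; ring
    rw [e1, e2, Real.cos_sub, Real.cos_add]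
    ring
  have h := intervalIntegral.integral_eq_sub_of_hasDerivAt hd
    (Continuous.intervalIntegrable (by fun_prop) _ _)
  rw [intervalIntegral.integral_sub ((hc k).const_mul _) (((hc _).sub (hc _)).const_mul _),
    intervalIntegral.integral_const_mul, intervalIntegral.integral_const_mul,
    intervalIntegral.integral_sub (hc _) (hc _)] at h
  simp only [mul_neg, Real.sin_neg, Real.sin_int_mul_pi, mul_zero, neg_zero, sub_zero] at h
  simp only [heatKernel₁_eq_integral]
  linear_combination (2 * Real.pi)⁻¹ * h

/-- In the recurrence at index j + 1 the left side is positive, hence so is the difference on the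
right. -/
lemma heatKernel₁_add_two_le (j : ℕ) {t : ℝ} (ht : 0 < t) :
    heatKernel₁ (j + 2 : ℕ) t ≤ heatKernel₁ (j : ℕ) t := by
  have h := mul_heatKernel₁ ((j + 1 : ℕ) : ℤ) t
  have e1 : ((j + 1 : ℕ) : ℤ) - 1 = (j : ℕ) := by push_cast; ring
  have e2 : ((j + 1 : ℕ) : ℤ) + 1 = (j + 2 : ℕ) := by push_cast; ring
  rw [e1, e2] at h
  have h0 := heatKernel₁_pos ((j + 1 : ℕ) : ℤ) ht
  have : 0 ≤ t * (heatKernel₁ (j : ℕ) t - heatKernel₁ (j + 2 : ℕ) t) := by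
    rw [← h]; positivity
  linarith [nonneg_of_mul_nonneg_right this ht]

lemma sum_heatKernel₁ (j n : ℕ) (t : ℝ) :
    ∑ i ∈ Finset.range n, ((j + 1 + 2 * i : ℕ) : ℝ) * heatKernel₁ (j + 1 + 2 * i : ℕ) t =
      t * (heatKernel₁ (j : ℕ) t - heatKernel₁ (j + 2 * n : ℕ) t) := by
  induction n with
  | zero => simp
  | succ n ih =>
    have h := mul_heatKernel₁ ((j + 1 + 2 * n : ℕ) : ℤ) t
    have e1 : ((j + 1 + 2 * n : ℕ) : ℤ) - 1 = (j + 2 * n : ℕ) := by push_cast; ring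
    have e2 : ((j + 1 + 2 * n : ℕ) : ℤ) + 1 = (j + 2 * (n + 1) : ℕ) := by push_cast; ring
    rw [e1, e2, Int.cast_natCast] at h
    rw [Finset.sum_range_succ, ih, h]
    ring

/-- The telescoped sum has n + 1 terms, each with weight at least j + 1 and kernel value at least
that of the last index. -/
lemma heatKernel₁_le_of_add (j n : ℕ) {t : ℝ} (ht : 0 < t) :
    ((j : ℝ) + 1) * (n + 1) * heatKernel₁ (j + 1 + 2 * n : ℕ) t ≤ t * heatKernel₁ (j : ℕ) t := by
  have hanti : Antitone fun i : ℕ => heatKernel₁ (j + 1 + 2 * i : ℕ) t :=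
    antitone_nat_of_succ_le fun i => heatKernel₁_add_two_le (j + 1 + 2 * i) ht
  have hpos := heatKernel₁_pos (j + 1 + 2 * n : ℕ) ht
  have h1 : ∑ i ∈ Finset.range (n + 1), ((j : ℝ) + 1) * heatKernel₁ (j + 1 + 2 * n : ℕ) t ≤
      ∑ i ∈ Finset.range (n + 1),
        ((j + 1 + 2 * i : ℕ) : ℝ) * heatKernel₁ (j + 1 + 2 * i : ℕ) t := by
    refine Finset.sum_le_sum fun i hi => ?_
    have : i ≤ n := by simpa [Nat.lt_succ_iff] using hi
    gcongr
    · push_cast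
      have : (0 : ℝ) ≤ i := by positivity
      linarith
    · exact hanti this
  rw [sum_heatKernel₁ j (n + 1) t, Finset.sum_const, Finset.card_range, nsmul_eq_mul] at h1
  have h2 := mul_pos ht (heatKernel₁_pos (j + 2 * (n + 1) : ℕ) ht)
  push_cast at h1 h2 ⊢
  linarith

lemma heatKernel₁_le_mul (k : ℕ) (hk : 1 ≤ k) {t : ℝ} (ht : 0 < t) :
    heatKernel₁ k t ≤ t := by
  obtain ⟨j, rfl⟩ := Nat.exists_eq_add_of_le' hk
  have h := heatKernel₁_le_of_add j 0 ht
  have h1 := heatKernel₁_le_one (j : ℕ) ht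
  have h2 := heatKernel₁_pos (j + 1 : ℕ) ht
  simp only [mul_zero, add_zero, Nat.cast_zero, zero_add, mul_one] at h
  have h3 : (0 : ℝ) ≤ j * heatKernel₁ (j + 1 : ℕ) t := by positivity
  nlinarith

lemma exists_heatKernel₁_descent (k : ℕ) (hk : 4 ≤ k) {t : ℝ} (ht : 0 < t) :
    ∃ j : ℕ, k ≤ 4 * j ∧ (k : ℝ) ^ 2 * heatKernel₁ k t ≤ 8 * t * heatKernel₁ j t := by
  -- With n = k / 4 and k = j + 1 + 2n, one has j + 1 ≥ k/2 and n + 1 ≥ k/4, whence the factor 8 =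
  -- 2·4.
  refine ⟨k - 1 - 2 * (k / 4), by omega, ?_⟩
  set j := k - 1 - 2 * (k / 4) with hj
  set n := k / 4 with hn
  have e : j + 1 + 2 * n = k := by omega
  have h := heatKernel₁_le_of_add j n ht
  rw [e] at h
  have h2 := heatKernel₁_pos (k : ℕ) ht
  have hj' : (k : ℝ) ≤ 2 * (j + 1) := by
    have : k ≤ 2 * (j + 1) := by omega
    exact_mod_cast this
  have hn' : (k : ℝ) ≤ 4 * (n + 1) := by
    have : k ≤ 4 * (n + 1) := by omega
    exact_mod_cast this
  have : (k : ℝ) ^ 2 ≤ (2 * (j + 1)) * (4 * (n + 1)) := by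
    rw [sq]; gcongr
  calc (k : ℝ) ^ 2 * heatKernel₁ k t ≤ (2 * (j + 1)) * (4 * (n + 1)) * heatKernel₁ k t := by
        gcongr
    _ = 8 * ((j + 1) * (n + 1) * heatKernel₁ k t) := by ring
    _ ≤ 8 * (t * heatKernel₁ j t) := by gcongr
    _ = _ := by ring

/-- The off-diagonal decay of the heat kernel, uniform in `t`. -/
lemma pow_four_mul_heatKernel₁_le (k : ℤ) (hk : 16 ≤ |k|) {t : ℝ} (ht : 0 < t) :
    (k : ℝ) ^ 4 * heatKernel₁ k t ≤ 1024 * (t ^ 2 * (√t)⁻¹) := by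
  have hcast : (k : ℝ) ^ 4 = (k.natAbs : ℝ) ^ 4 := by
    rw [Nat.cast_natAbs, Int.cast_abs, Even.pow_abs (by decide)]
  rw [← heatKernel₁_natAbs k t, hcast]
  rw [Int.abs_eq_natAbs] at hk
  generalize k.natAbs = m at hk
  -- Each descent gains a factor 8t/k²; m ≥ 16 forces j ≥ 4, so that a second one is allowed.
  obtain ⟨j, hj, h1⟩ := exists_heatKernel₁_descent m (by omega) ht
  obtain ⟨i, -, h2⟩ := exists_heatKernel₁_descent j (by omega) ht
  have h3 := heatKernel₁_le_inv_sqrt (i : ℤ) ht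
  have hj' : (m : ℝ) ≤ 4 * j := by exact_mod_cast hj
  have hp := heatKernel₁_pos (m : ℤ) ht
  have hpj := heatKernel₁_pos (j : ℤ) ht
  calc (m : ℝ) ^ 4 * heatKernel₁ m t = (m : ℝ) ^ 2 * ((m : ℝ) ^ 2 * heatKernel₁ m t) := by ring
    _ ≤ (4 * j) ^ 2 * (8 * t * heatKernel₁ j t) := by gcongr
    _ = 128 * t * ((j : ℝ) ^ 2 * heatKernel₁ j t) := by ring
    _ ≤ 128 * t * (8 * t * heatKernel₁ i t) := by gcongr
    _ ≤ 128 * t * (8 * t * (√t)⁻¹) := by gcongr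
    _ = _ := by ring

end Bounds

/-! ### Local central limit theorem under diffusive scaling. -/

section LocalLimit

lemma integral_exp_neg_mul_sq_mul_cos {u : ℝ} (hu : 0 < u) (w : ℝ) :
    ∫ x : ℝ, Real.exp (-u * x ^ 2) * Real.cos (w * x) =
      √(Real.pi / u) * Real.exp (-w ^ 2 / (4 * u)) := by
  have hb : 0 < (u : ℂ).re := by simpa using hu
  have h := fourierIntegral_gaussian hb (w : ℂ)
  have hR : ((Real.pi : ℂ) / u) ^ (1 / 2 : ℂ) * Complex.exp (-(w : ℂ) ^ 2 / (4 * u)) =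
      ((√(Real.pi / u) * Real.exp (-w ^ 2 / (4 * u)) : ℝ) : ℂ) := by
    rw [Real.sqrt_eq_rpow, Complex.ofReal_mul, Complex.ofReal_cpow (by positivity)]
    push_cast
    rfl
  have hint : Integrable fun x : ℝ =>
      Complex.exp (Complex.I * w * x) * Complex.exp (-u * (x : ℂ) ^ 2) := by
    refine (integrable_cexp_neg_mul_sq hb).bdd_mul (c := 1)
      (Continuous.aestronglyMeasurable (by fun_prop)) (Eventually.of_forall fun x => ?_)
    have : Complex.I * w * x = ((w * x : ℝ) : ℂ) * Complex.I := by push_cast; ring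
    rw [this, Complex.norm_exp_ofReal_mul_I]
  have h' := congrArg Complex.re (h.trans hR)
  rw [Complex.ofReal_re] at h'
  rw [← h']
  have hre := integral_re (𝕜 := ℂ) hint
  simp only [RCLike.re_to_complex] at hre
  rw [← hre]
  refine integral_congr_ae (Eventually.of_forall fun x => ?_)
  have e1 : Complex.I * w * x = ((w * x : ℝ) : ℂ) * Complex.I := by push_cast; ring
  have e2 : Complex.exp (-u * (x : ℂ) ^ 2) = ((Real.exp (-u * x ^ 2) : ℝ) : ℂ) := by
    push_cast; rfl
  simp only [e1, e2]
  rw [mul_comm (Complex.exp _), Complex.re_ofReal_mul, Complex.exp_ofReal_mul_I_re]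

/-- The symbol of the heat semigroup at time `N ^ 2 * u`, on the torus rescaled by `N`. -/
noncomputable def scaledSymbol (u N ξ : ℝ) : ℝ :=
  (Set.Ioc (-Real.pi * N) (Real.pi * N)).indicator
    (fun ξ => Real.exp (-(2 * (N ^ 2 * u) * (1 - Real.cos (ξ / N))))) ξ

lemma measurable_scaledSymbol (u N : ℝ) : Measurable (scaledSymbol u N) :=
  Measurable.indicator (by fun_prop) measurableSet_Ioc

lemma scaledSymbol_nonneg (u N ξ : ℝ) : 0 ≤ scaledSymbol u N ξ :=
  Set.indicator_nonneg (fun _ _ => (Real.exp_pos _).le) _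

lemma scaledSymbol_le {u N : ℝ} (hu : 0 ≤ u) (hN : 0 < N) (ξ : ℝ) :
    scaledSymbol u N ξ ≤ Real.exp (-(4 * u / Real.pi ^ 2) * ξ ^ 2) := by
  refine Set.indicator_apply_le' (fun hξ => ?_) fun _ => (Real.exp_pos _).le
  have h : |ξ / N| ≤ Real.pi := by
    rw [abs_div, abs_of_pos hN, div_le_iff₀ hN, abs_le]
    exact ⟨by linarith [hξ.1], hξ.2⟩
  refine (exp_neg_one_sub_cos_le (by positivity) h).trans_eq ?_
  congr 1
  field_simp

lemma tendsto_scaledSymbol (u ξ : ℝ) :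
    Tendsto (fun N => scaledSymbol u N ξ) atTop (𝓝 (Real.exp (-u * ξ ^ 2))) := by
  have hpi := Real.pi_pos
  have h1 : Tendsto (fun N : ℝ => ξ / 2 / N) atTop (𝓝 0) := tendsto_const_nhds.div_atTop tendsto_id
  -- Since 1 - cos(ξ/N) = 2 sin²(ξ/(2N)), the symbol's exponent is exactly this one once ξ lies in
  -- the rescaled torus.
  have h2 : Tendsto (fun N : ℝ => Real.exp (-u * (ξ * Real.sinc (ξ / 2 / N)) ^ 2)) atTop
      (𝓝 (Real.exp (-u * ξ ^ 2))) := by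
    have := (Real.continuous_sinc.tendsto 0).comp h1
    rw [Real.sinc_zero] at this
    have h3 := ((this.const_mul ξ).pow 2).const_mul (-u)
    rw [mul_one] at h3
    exact (Real.continuous_exp.tendsto _).comp h3
  refine h2.congr' ?_
  filter_upwards [eventually_gt_atTop 0, eventually_gt_atTop (|ξ| / Real.pi)] with N hN hN'
  rw [div_lt_iff₀ hpi, mul_comm, abs_lt] at hN'
  have hmem : ξ ∈ Set.Ioc (-Real.pi * N) (Real.pi * N) := ⟨by linarith [hN'.1], hN'.2.le⟩
  rw [scaledSymbol, Set.indicator_of_mem hmem]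
  congr 1
  have hcos : 1 - Real.cos (ξ / N) = 2 * Real.sin (ξ / 2 / N) ^ 2 := by
    have : ξ / N = 2 * (ξ / 2 / N) := by ring
    rw [this, Real.cos_two_mul, Real.cos_sq']
    ring
  rcases eq_or_ne ξ 0 with h0 | h0
  · simp [h0]
  rw [hcos, Real.sinc_of_ne_zero (by positivity)]
  field_simp

lemma integrable_scaledSymbol {u N : ℝ} (hu : 0 < u) (hN : 0 < N) :
    Integrable (scaledSymbol u N) := by
  have hpi := Real.pi_pos
  refine (integrable_exp_neg_mul_sq (b := 4 * u / Real.pi ^ 2) (by positivity)).mono'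
    (measurable_scaledSymbol u N).aestronglyMeasurable (Eventually.of_forall fun ξ => ?_)
  rw [Real.norm_of_nonneg (scaledSymbol_nonneg u N ξ)]
  exact scaledSymbol_le hu.le hN ξ

/-- Convergence in L¹ of the symbols controls all Fourier coefficients at once; this makes the local
limit uniform in k. -/
lemma tendsto_integral_abs_scaledSymbol_sub {u : ℝ} (hu : 0 < u) :
    Tendsto (fun N => ∫ ξ, |scaledSymbol u N ξ - Real.exp (-u * ξ ^ 2)|) atTop (𝓝 0) := by
  have hpi := Real.pi_pos
  have hb : 0 < 4 * u / Real.pi ^ 2 := by positivity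
  have hbu : 4 * u / Real.pi ^ 2 ≤ u := by
    rw [div_le_iff₀ (by positivity)]
    have : 4 ≤ Real.pi ^ 2 := by nlinarith [Real.pi_gt_three]
    nlinarith
  have h := tendsto_integral_filter_of_dominated_convergence (μ := (volume : Measure ℝ))
    (l := (atTop : Filter ℝ))
    (F := fun N ξ => |scaledSymbol u N ξ - Real.exp (-u * ξ ^ 2)|) (f := fun _ => 0)
    (fun ξ => Real.exp (-(4 * u / Real.pi ^ 2) * ξ ^ 2))
    (Eventually.of_forall fun N => by
      have := measurable_scaledSymbol u N
      exact Measurable.aestronglyMeasurable (by fun_prop))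
    (by
      filter_upwards [eventually_gt_atTop 0] with N hN
      refine Eventually.of_forall fun ξ => ?_
      have h1 := scaledSymbol_nonneg u N ξ
      have h2 := scaledSymbol_le hu.le hN ξ
      have h3 : Real.exp (-u * ξ ^ 2) ≤ Real.exp (-(4 * u / Real.pi ^ 2) * ξ ^ 2) := by
        gcongr
      have h4 := Real.exp_pos (-u * ξ ^ 2)
      rw [Real.norm_eq_abs, abs_abs, abs_le]
      constructor <;> linarith)
    (integrable_exp_neg_mul_sq hb)
    (Eventually.of_forall fun ξ => by
      have := ((tendsto_scaledSymbol u ξ).sub_const (Real.exp (-u * ξ ^ 2))).abs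
      simpa using this)
  simpa using h

lemma mul_heatKernel₁_scaled (k : ℤ) (u : ℝ) {N : ℝ} (hN : 0 < N) :
    N * heatKernel₁ k (N ^ 2 * u) =
      (2 * Real.pi)⁻¹ * ∫ ξ, scaledSymbol u N ξ * Real.cos (k / N * ξ) := by
  have hpi := Real.pi_pos
  have h := intervalIntegral.integral_comp_div (a := -Real.pi * N) (b := Real.pi * N)
    (fun θ => Real.exp (-(2 * (N ^ 2 * u) * (1 - Real.cos θ))) * Real.cos (k * θ)) hN.ne'
  rw [mul_div_cancel_right₀ _ hN.ne', mul_div_cancel_right₀ _ hN.ne', smul_eq_mul] at h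
  rw [heatKernel₁_eq_integral, mul_left_comm, ← h,
    intervalIntegral.integral_of_le (by nlinarith), ← integral_indicator measurableSet_Ioc]
  congr 2
  funext ξ
  rw [scaledSymbol, div_mul_eq_mul_div, mul_div_assoc]
  exact Set.indicator_mul_left _ _ fun ξ => Real.cos (k * (ξ / N))

lemma gaussian_eq_integral (w : ℝ) {u : ℝ} (hu : 0 < u) :
    (√(4 * Real.pi * u))⁻¹ * Real.exp (-w ^ 2 / (4 * u)) =
      (2 * Real.pi)⁻¹ * ∫ ξ : ℝ, Real.exp (-u * ξ ^ 2) * Real.cos (w * ξ) := by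
  have hpi := Real.pi_pos
  rw [integral_exp_neg_mul_sq_mul_cos hu, ← mul_assoc]
  congr 1
  have h1 : 4 * Real.pi * u = (2 * Real.pi) ^ 2 / (Real.pi / u) := by field_simp; ring
  rw [h1, Real.sqrt_div (by positivity), Real.sqrt_sq (by positivity), inv_div, div_eq_inv_mul]

/-- The local central limit theorem for the heat kernel, uniformly in `k`. -/
lemma abs_mul_heatKernel₁_sub_le (k : ℤ) {u N : ℝ} (hu : 0 < u) (hN : 0 < N) :
    |N * heatKernel₁ k (N ^ 2 * u) -
        (√(4 * Real.pi * u))⁻¹ * Real.exp (-(k / N) ^ 2 / (4 * u))| ≤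
      (2 * Real.pi)⁻¹ * ∫ ξ, |scaledSymbol u N ξ - Real.exp (-u * ξ ^ 2)| := by
  have hpi := Real.pi_pos
  have hbdd : ∀ {f : ℝ → ℝ}, Integrable f → Integrable fun ξ => f ξ * Real.cos (k / N * ξ) :=
    fun hf => hf.mul_bdd (c := 1) (Continuous.aestronglyMeasurable (by fun_prop))
      (Eventually.of_forall fun ξ => Real.abs_cos_le_one _)
  have hg := integrable_exp_neg_mul_sq hu
  have hs := integrable_scaledSymbol hu hN
  rw [mul_heatKernel₁_scaled k u hN, gaussian_eq_integral _ hu, ← mul_sub,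
    ← integral_sub (hbdd hs) (hbdd hg), abs_mul, abs_of_pos (by positivity)]
  gcongr
  refine abs_integral_le_integral_abs.trans
    (integral_mono_of_nonneg (Eventually.of_forall fun _ => abs_nonneg _) (hs.sub hg).abs
      (Eventually.of_forall fun ξ => ?_))
  simp only [← sub_mul, abs_mul]
  exact mul_le_of_le_one_right (abs_nonneg _) (Real.abs_cos_le_one _)

lemma euclNorm_sq (m : ℤ × ℤ) : euclNorm m ^ 2 = (m.1 : ℝ) ^ 2 + (m.2 : ℝ) ^ 2 :=
  Real.sq_sqrt (by positivity)

lemma mul_heatKernel₁_scaled_le (k : ℤ) {u N : ℝ} (hu : 0 < u) (hN : 0 < N) :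
    N * heatKernel₁ k (N ^ 2 * u) ≤ (√u)⁻¹ := by
  have h := heatKernel₁_le_inv_sqrt k (t := N ^ 2 * u) (by positivity)
  rw [Real.sqrt_mul (by positivity), Real.sqrt_sq hN.le] at h
  calc _ ≤ N * (N * √u)⁻¹ := by gcongr
    _ = _ := by field_simp

lemma tendsto_heatKernel₂_scaled {u : ℝ} (hu : 0 < u) :
    Tendsto (fun m => euclNorm m ^ 2 * heatKernel₂ m (euclNorm m ^ 2 * u))
      (comap euclNorm atTop) (𝓝 ((4 * Real.pi * u)⁻¹ * Real.exp (-1 / (4 * u)))) := by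
  have hpi := Real.pi_pos
  set ε : ℝ → ℝ := fun N =>
    (2 * Real.pi)⁻¹ * ∫ ξ, |scaledSymbol u N ξ - Real.exp (-u * ξ ^ 2)| with hε
  have hlim : Tendsto (fun m : ℤ × ℤ =>
      ε (euclNorm m) * ((√u)⁻¹ + (√(4 * Real.pi * u))⁻¹)) (comap euclNorm atTop) (𝓝 0) := by
    have h := ((tendsto_integral_abs_scaledSymbol_sub hu).const_mul (2 * Real.pi)⁻¹).mul_const
      ((√u)⁻¹ + (√(4 * Real.pi * u))⁻¹)
    simp only [mul_zero, zero_mul] at h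
    exact h.comp tendsto_comap
  rw [tendsto_iff_norm_sub_tendsto_zero]
  refine squeeze_zero' (Eventually.of_forall fun _ => norm_nonneg _) ?_ hlim
  filter_upwards [tendsto_comap.eventually (eventually_gt_atTop 0)] with m hm
  have hsq := euclNorm_sq m
  set N := euclNorm m
  have hA := abs_mul_heatKernel₁_sub_le m.1 hu hm
  have hB := abs_mul_heatKernel₁_sub_le m.2 hu hm
  set a := N * heatKernel₁ m.1 (N ^ 2 * u) with ha
  set b := N * heatKernel₁ m.2 (N ^ 2 * u) with hb
  set A := (√(4 * Real.pi * u))⁻¹ * Real.exp (-(m.1 / N) ^ 2 / (4 * u)) with hA'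
  set B := (√(4 * Real.pi * u))⁻¹ * Real.exp (-(m.2 / N) ^ 2 / (4 * u)) with hB'
  have hab : N ^ 2 * heatKernel₂ m (N ^ 2 * u) = a * b := by rw [heatKernel₂]; ring
  have hAB : (4 * Real.pi * u)⁻¹ * Real.exp (-1 / (4 * u)) = A * B := by
    rw [hA', hB', mul_mul_mul_comm, ← mul_inv, Real.mul_self_sqrt (by positivity), ← Real.exp_add,
      ← add_div]
    congr 3
    have : N ^ 2 ≠ 0 := by positivity
    field_simp
    linarith
  have hbn : |b| ≤ (√u)⁻¹ := by
    rw [abs_of_nonneg (mul_nonneg hm.le (heatKernel₁_pos _ (by positivity)).le)]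
    exact mul_heatKernel₁_scaled_le _ hu hm
  have hAn : |A| ≤ (√(4 * Real.pi * u))⁻¹ := by
    rw [abs_of_nonneg (by positivity)]
    refine mul_le_of_le_one_right (by positivity) (Real.exp_le_one_iff.2 ?_)
    exact div_nonpos_of_nonpos_of_nonneg (neg_nonpos.2 (sq_nonneg _)) (by positivity)
  rw [hab, hAB, Real.norm_eq_abs]
  -- Only b and A need to be bounded independently of m; both differences tend to zero.
  calc |a * b - A * B| = |(a - A) * b + (b - B) * A| := by ring_nf
    _ ≤ |a - A| * |b| + |b - B| * |A| := by
      rw [← abs_mul, ← abs_mul]; exact abs_add_le _ _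
    _ ≤ ε N * (√u)⁻¹ + ε N * (√(4 * Real.pi * u))⁻¹ := by
      have : 0 ≤ ε N := (abs_nonneg _).trans hA
      gcongr
    _ = _ := by ring

end LocalLimit

/-! ### Integrability, positivity and asymptotics of the fractional kernel. -/

section Kernel

/-- The integrand is u^(-s) near zero and u^(-2-s) at infinity. It serves as majorant both for fixed
m and in the limit. -/
lemma integrableOn_min_inv_div_rpow {s : ℝ} (hs0 : 0 < s) (hs1 : s < 1) :
    IntegrableOn (fun u : ℝ => min u u⁻¹ / u ^ (1 + s)) (Set.Ioi 0) := by
  rw [← Set.Ioc_union_Ioi_eq_Ioi zero_le_one]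
  refine IntegrableOn.union ?_ ?_
  · have h : IntegrableOn (fun u : ℝ => u ^ (-s)) (Set.Ioc 0 1) := by
      rw [← intervalIntegrable_iff_integrableOn_Ioc_of_le zero_le_one]
      exact intervalIntegral.intervalIntegrable_rpow' (by linarith)
    refine h.congr_fun (fun u hu => ?_) measurableSet_Ioc
    have h1 : u ≤ u⁻¹ := hu.2.trans (one_le_inv_iff₀.2 hu)
    simp only [min_eq_left h1]
    rw [Real.rpow_add hu.1, Real.rpow_one, Real.rpow_neg hu.1.le]
    have := hu.1
    field_simp
  · have h : IntegrableOn (fun u : ℝ => u ^ (-(2 + s))) (Set.Ioi 1) :=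
      integrableOn_Ioi_rpow_of_lt (by linarith) one_pos
    refine h.congr_fun (fun u hu => ?_) measurableSet_Ioi
    have hu' : (1 : ℝ) < u := hu
    have hu0 : 0 < u := by linarith
    have h1 : u⁻¹ ≤ u := (inv_le_one_of_one_le₀ hu'.le).trans hu'.le
    simp only [min_eq_right h1]
    have : (2 : ℝ) + s = 1 + (1 + s) := by ring
    rw [Real.rpow_neg hu0.le, this, Real.rpow_add hu0, Real.rpow_one, mul_inv, div_eq_mul_inv]

lemma continuous_heatKernel₂ (m : ℤ × ℤ) : Continuous (heatKernel₂ m) :=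
  (continuous_heatKernel₁ m.1).mul (continuous_heatKernel₁ m.2)

lemma heatKernel₂_pos (m : ℤ × ℤ) {t : ℝ} (ht : 0 < t) : 0 < heatKernel₂ m t :=
  mul_pos (heatKernel₁_pos _ ht) (heatKernel₁_pos _ ht)

lemma heatKernel₂_le_inv (m : ℤ × ℤ) {t : ℝ} (ht : 0 < t) : heatKernel₂ m t ≤ t⁻¹ :=
  calc _ ≤ (√t)⁻¹ * (√t)⁻¹ := mul_le_mul (heatKernel₁_le_inv_sqrt _ ht)
        (heatKernel₁_le_inv_sqrt _ ht) (heatKernel₁_pos _ ht).le (by positivity)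
    _ = _ := by rw [← mul_inv, Real.mul_self_sqrt ht.le]

lemma heatKernel₁_le_self {k : ℤ} (hk : k ≠ 0) {t : ℝ} (ht : 0 < t) : heatKernel₁ k t ≤ t := by
  rw [← heatKernel₁_natAbs]
  exact heatKernel₁_le_mul _ (Int.natAbs_pos.2 hk) ht

lemma heatKernel₂_le_self {m : ℤ × ℤ} (hm : m ≠ 0) {t : ℝ} (ht : 0 < t) :
    heatKernel₂ m t ≤ t := by
  by_cases h : m.1 = 0
  · have h2 : m.2 ≠ 0 := fun h2 => hm (Prod.ext h h2)
    calc _ ≤ 1 * t := mul_le_mul (heatKernel₁_le_one _ ht) (heatKernel₁_le_self h2 ht)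
          (heatKernel₁_pos _ ht).le zero_le_one
      _ = t := one_mul t
  · calc _ ≤ t * 1 := mul_le_mul (heatKernel₁_le_self h ht) (heatKernel₁_le_one _ ht)
          (heatKernel₁_pos _ ht).le ht.le
      _ = t := mul_one t

lemma measurable_heatKernel₂_div (m : ℤ × ℤ) (s c : ℝ) :
    Measurable fun t : ℝ => heatKernel₂ m (c * t) / t ^ (1 + s) := by
  have := (continuous_heatKernel₂ m).measurable
  fun_prop

lemma integrableOn_heatKernel₂_div {s : ℝ} (hs0 : 0 < s) (hs1 : s < 1) {m : ℤ × ℤ}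
    (hm : m ≠ 0) :
    IntegrableOn (fun t : ℝ => heatKernel₂ m t / t ^ (1 + s)) (Set.Ioi 0) := by
  refine Integrable.mono' (integrableOn_min_inv_div_rpow hs0 hs1)
    (by simpa using (measurable_heatKernel₂_div m s 1).aestronglyMeasurable) ?_
  refine (ae_restrict_iff' measurableSet_Ioi).2 (Eventually.of_forall fun t ht => ?_)
  have ht' : 0 < t := ht
  have := heatKernel₂_pos m ht'
  rw [Real.norm_of_nonneg (by positivity)]
  gcongr
  exact le_min (heatKernel₂_le_self hm ht') (heatKernel₂_le_inv m ht')

lemma abs_Gamma_neg_pos {s : ℝ} (hs0 : 0 < s) (hs1 : s < 1) : 0 < |Real.Gamma (-s)| := by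
  refine abs_pos.2 (Real.Gamma_ne_zero fun n h => ?_)
  have h' : s = n := by linarith
  rw [h'] at hs0 hs1
  have h0 : 0 < n := by exact_mod_cast hs0
  have h1 : n < 1 := by exact_mod_cast hs1
  omega

lemma fracKernel_pos {s : ℝ} (hs0 : 0 < s) (hs1 : s < 1) {m : ℤ × ℤ} (hm : m ≠ 0) :
    0 < fracKernel s m := by
  have hG := abs_Gamma_neg_pos hs0 hs1
  have hpos : ∀ t ∈ Set.Ioi (0 : ℝ), 0 < heatKernel₂ m t / t ^ (1 + s) := fun t ht =>
    div_pos (heatKernel₂_pos m ht) (Real.rpow_pos_of_pos ht _)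
  rw [fracKernel, if_neg hm]
  refine mul_pos (by positivity) ?_
  rw [setIntegral_pos_iff_support_of_nonneg_ae
    ((ae_restrict_iff' measurableSet_Ioi).2 (Eventually.of_forall fun t ht => (hpos t ht).le))
    (integrableOn_heatKernel₂_div hs0 hs1 hm),
    Set.inter_eq_right.2 fun t ht => Function.mem_support.2 (hpos t ht).ne']
  simp

/-- Here k plays the larger coordinate, whose square is at least N²/2. Fourth-power decay in k and
t^(-1/2) for l combine to 4·1024·t/N⁴, and t = N²u. -/
lemma heatKernel₁_mul_scaled_le {k l : ℤ} {N u : ℝ} (hN : 32 ≤ N) (hu : 0 < u)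
    (hk : N ^ 2 ≤ 2 * (k : ℝ) ^ 2) :
    N ^ 2 * (heatKernel₁ k (N ^ 2 * u) * heatKernel₁ l (N ^ 2 * u)) ≤ 4096 * u := by
  have ht : 0 < N ^ 2 * u := by positivity
  -- If |k| < 16, then 2k² ≤ 512 < 32² ≤ N².
  have hk16 : 16 ≤ |k| := by
    by_contra! h
    have h1 : |(k : ℝ)| ≤ 16 := by exact_mod_cast h.le
    have h2 : (k : ℝ) ^ 2 ≤ 16 ^ 2 := by
      rw [← sq_abs]; gcongr
    nlinarith
  have h1 := pow_four_mul_heatKernel₁_le k hk16 ht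
  have h2 := heatKernel₁_le_inv_sqrt l ht
  have hpk := heatKernel₁_pos k ht
  have hpl := heatKernel₁_pos l ht
  have h3 : N ^ 4 ≤ 4 * (k : ℝ) ^ 4 := by
    calc N ^ 4 = (N ^ 2) ^ 2 := by ring
      _ ≤ (2 * (k : ℝ) ^ 2) ^ 2 := by gcongr
      _ = _ := by ring
  set t := N ^ 2 * u
  have hst : (√t)⁻¹ * (√t)⁻¹ = t⁻¹ := by rw [← mul_inv, Real.mul_self_sqrt ht.le]
  have h4 : N ^ 4 * (heatKernel₁ k t * heatKernel₁ l t) ≤ N ^ 2 * (4096 * u) :=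
    calc _ ≤ 4 * (k : ℝ) ^ 4 * (heatKernel₁ k t * heatKernel₁ l t) := by gcongr
      _ = 4 * ((k : ℝ) ^ 4 * heatKernel₁ k t) * heatKernel₁ l t := by ring
      _ ≤ 4 * (1024 * (t ^ 2 * (√t)⁻¹)) * (√t)⁻¹ := by gcongr
      _ = 4096 * (t ^ 2 * ((√t)⁻¹ * (√t)⁻¹)) := by ring
      _ = 4096 * t := by rw [hst]; field_simp
      _ = N ^ 2 * (4096 * u) := by ring
  have h5 : N ^ 2 * (N ^ 2 * (heatKernel₁ k t * heatKernel₁ l t)) ≤ N ^ 2 * (4096 * u) := by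
    linarith
  exact le_of_mul_le_mul_left h5 (by positivity)

lemma heatKernel₂_scaled_le {m : ℤ × ℤ} (hm : 32 ≤ euclNorm m) {u : ℝ} (hu : 0 < u) :
    euclNorm m ^ 2 * heatKernel₂ m (euclNorm m ^ 2 * u) ≤ 4096 * min u u⁻¹ := by
  have hsq := euclNorm_sq m
  rw [mul_min_of_nonneg _ _ (by norm_num)]
  refine le_min ?_ ?_
  · rcases le_total ((m.2 : ℝ) ^ 2) ((m.1 : ℝ) ^ 2) with h | h
    · exact heatKernel₁_mul_scaled_le hm hu (by linarith)
    · rw [heatKernel₂, mul_comm (heatKernel₁ m.1 _)]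
      exact heatKernel₁_mul_scaled_le hm hu (by linarith)
  · have h := heatKernel₂_le_inv m (t := euclNorm m ^ 2 * u) (by positivity)
    calc _ ≤ euclNorm m ^ 2 * (euclNorm m ^ 2 * u)⁻¹ := by gcongr
      _ = 1 * u⁻¹ := by field_simp
      _ ≤ _ := by gcongr; norm_num

lemma tendsto_integral_heatKernel₂_scaled {s : ℝ} (hs0 : 0 < s) (hs1 : s < 1) :
    Tendsto (fun m => ∫ u in Set.Ioi (0 : ℝ),
        euclNorm m ^ 2 * (heatKernel₂ m (euclNorm m ^ 2 * u) / u ^ (1 + s)))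
      (comap euclNorm atTop)
      (𝓝 (∫ u in Set.Ioi (0 : ℝ),
        (4 * Real.pi * u)⁻¹ * Real.exp (-1 / (4 * u)) / u ^ (1 + s))) := by
  refine tendsto_integral_filter_of_dominated_convergence
    (fun u => 4096 * (min u u⁻¹ / u ^ (1 + s)))
    (Eventually.of_forall fun m =>
      ((measurable_heatKernel₂_div m s _).const_mul _).aestronglyMeasurable) ?_
    ((integrableOn_min_inv_div_rpow hs0 hs1).const_mul _) ?_
  · filter_upwards [tendsto_comap.eventually (eventually_ge_atTop 32)] with m hm
    refine (ae_restrict_iff' measurableSet_Ioi).2 (Eventually.of_forall fun u hu => ?_)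
    have hu' : 0 < u := hu
    have := heatKernel₂_pos m (t := euclNorm m ^ 2 * u) (by positivity)
    rw [Real.norm_of_nonneg (by positivity), ← mul_div_assoc, ← mul_div_assoc]
    exact div_le_div_of_nonneg_right (heatKernel₂_scaled_le hm hu') (by positivity)
  · refine (ae_restrict_iff' measurableSet_Ioi).2 (Eventually.of_forall fun u hu => ?_)
    simp only [← mul_div_assoc]
    exact (tendsto_heatKernel₂_scaled hu).div_const _

lemma integral_gaussian_div_rpow {s : ℝ} (hs0 : 0 < s) :
    ∫ u in Set.Ioi (0 : ℝ), (4 * Real.pi * u)⁻¹ * Real.exp (-1 / (4 * u)) / u ^ (1 + s) =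
      4 ^ s * Real.Gamma (1 + s) / Real.pi := by
  have hpi := Real.pi_pos
  have h1 := Real.integral_rpow_mul_exp_neg_mul_Ioi (a := 1 + s) (r := 1 / 4) (by linarith)
    (by norm_num)
  -- The change of variable x = 1/u, with Jacobian u⁻², turns the Gamma integral of x^s e^(-x/4)
  -- into the required one.
  rw [← integral_comp_rpow_Ioi _ (neg_ne_zero.2 one_ne_zero)] at h1
  have h2 : ∫ u in Set.Ioi (0 : ℝ),
      (4 * Real.pi * u)⁻¹ * Real.exp (-1 / (4 * u)) / u ^ (1 + s) =
      (4 * Real.pi)⁻¹ * ((1 / (1 / 4)) ^ (1 + s) * Real.Gamma (1 + s)) := by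
    rw [← h1, ← integral_const_mul]
    refine setIntegral_congr_fun measurableSet_Ioi fun u hu => ?_
    have hu' : (0 : ℝ) < u := hu
    have e1 : u ^ (-1 : ℝ) = u⁻¹ := Real.rpow_neg_one u
    have e2 : u ^ (-1 - 1 : ℝ) = (u ^ 2)⁻¹ := by
      rw [show (-1 - 1 : ℝ) = -(2 : ℕ) by norm_num, Real.rpow_neg hu'.le, Real.rpow_natCast]
    have e3 : (u⁻¹) ^ (1 + s - 1) = (u ^ s)⁻¹ := by
      rw [add_sub_cancel_left, Real.inv_rpow hu'.le]
    have e4 : -(1 / 4 * u⁻¹) = -1 / (4 * u) := by field_simp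
    simp only [smul_eq_mul, e1, e2, e3, e4, abs_neg, abs_one]
    rw [Real.rpow_add hu', Real.rpow_one]
    field_simp
  rw [h2, one_div_one_div, Real.rpow_add (by norm_num), Real.rpow_one]
  field_simp

/-- Under t = N²u the measure contributes N² and t^(-1-s) contributes N^(-2-2s), cancelling the
normalising power. -/
lemma fracKernel_mul_euclNorm_rpow (s : ℝ) {m : ℤ × ℤ} (hm : 0 < euclNorm m) :
    fracKernel s m * euclNorm m ^ (2 + 2 * s) = 1 / |Real.Gamma (-s)| *
      ∫ u in Set.Ioi (0 : ℝ),
        euclNorm m ^ 2 * (heatKernel₂ m (euclNorm m ^ 2 * u) / u ^ (1 + s)) := by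
  have hm0 : m ≠ 0 := by
    rintro rfl
    simp [euclNorm] at hm
  rw [fracKernel, if_neg hm0, mul_assoc]
  congr 1
  set N := euclNorm m
  have hN2 : 0 < N ^ 2 := by positivity
  have h := integral_comp_mul_left_Ioi (fun t => heatKernel₂ m t / t ^ (1 + s)) 0 hN2
  rw [mul_zero, smul_eq_mul, eq_inv_mul_iff_mul_eq₀ hN2.ne'] at h
  have hpow : N ^ (2 + 2 * s) = (N ^ 2) ^ (1 + s) := by
    rw [← Real.rpow_natCast, ← Real.rpow_mul hm.le]
    congr 1
    push_cast
    ring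
  rw [← h, hpow, ← integral_const_mul, ← integral_mul_const]
  refine setIntegral_congr_fun measurableSet_Ioi fun u hu => ?_
  have hu' : (0 : ℝ) < u := hu
  have hp : 0 < (N ^ 2) ^ (1 + s) := by positivity
  simp only [Real.mul_rpow hN2.le hu'.le]
  field_simp

lemma tendsto_fracKernel_mul {s : ℝ} (hs0 : 0 < s) (hs1 : s < 1) :
    Tendsto (fun m => fracKernel s m * euclNorm m ^ (2 + 2 * s)) (comap euclNorm atTop)
      (𝓝 (fracConst s)) := by
  have h := (tendsto_integral_heatKernel₂_scaled hs0 hs1).const_mul (1 / |Real.Gamma (-s)|)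
  rw [integral_gaussian_div_rpow hs0] at h
  have hc : fracConst s = 1 / |Real.Gamma (-s)| * (4 ^ s * Real.Gamma (1 + s) / Real.pi) := by
    rw [fracConst, div_mul_div_comm, one_mul, mul_comm Real.pi]
  rw [hc]
  refine h.congr' ?_
  filter_upwards [tendsto_comap.eventually (eventually_gt_atTop 0)] with m hm
  exact (fracKernel_mul_euclNorm_rpow s hm).symm

lemma isLittleO_fracKernel_sub {s : ℝ} (hs0 : 0 < s) (hs1 : s < 1) :
    (fun m : ℤ × ℤ => fracKernel s m - fracConst s / euclNorm m ^ (2 + 2 * s))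
      =o[comap euclNorm atTop] (fun m : ℤ × ℤ => 1 / euclNorm m ^ (2 + 2 * s)) := by
  have hpos : ∀ᶠ m in comap euclNorm atTop, 0 < euclNorm m :=
    tendsto_comap.eventually (eventually_gt_atTop 0)
  have hpow : ∀ᶠ m in comap euclNorm atTop, 0 < euclNorm m ^ (2 + 2 * s) :=
    hpos.mono fun m hm => Real.rpow_pos_of_pos hm _
  rw [isLittleO_iff_tendsto' (hpow.mono fun m hm h => absurd h (by positivity))]
  have h := (tendsto_fracKernel_mul hs0 hs1).sub_const (fracConst s)
  rw [sub_self] at h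
  refine h.congr' ?_
  filter_upwards [hpow] with m hm
  rw [div_div_eq_mul_div, div_one, sub_mul, div_mul_cancel₀ _ hm.ne']

lemma abs_fst_le_euclNorm (m : ℤ × ℤ) : |(m.1 : ℝ)| ≤ euclNorm m :=
  Real.abs_le_sqrt (by nlinarith [sq_nonneg (m.2 : ℝ)])

/-- One coordinate escaping to infinity is enough for the norm to do so. -/
lemma tendsto_euclNorm_bothToInfinity : Tendsto euclNorm bothToInfinity atTop := by
  have h : Tendsto (fun k : ℤ => |(k : ℝ)|) (atBot ⊔ atTop) atTop :=
    tendsto_sup.2 ⟨tendsto_abs_atBot_atTop.comp (tendsto_intCast_atBot_iff.2 tendsto_id),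
      tendsto_abs_atTop_atTop.comp tendsto_intCast_atTop_atTop⟩
  exact tendsto_atTop_mono abs_fst_le_euclNorm (h.comp tendsto_fst)

end Kernel

end DiscreteFractional

theorem lemma5p1 (s : ℝ) (hs0 : 0 < s) (hs1 : s < 1) :
    (∀ m : ℤ × ℤ, m ≠ 0 →
      MeasureTheory.IntegrableOn
        (fun t : ℝ => DiscreteFractional.heatKernel₂ m t / t ^ (1 + s)) (Set.Ioi 0) ∧
      0 < DiscreteFractional.fracKernel s m) ∧
    (fun m : ℤ × ℤ => DiscreteFractional.fracKernel s m -
        DiscreteFractional.fracConst s / DiscreteFractional.euclNorm m ^ (2 + 2 * s))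
      =o[DiscreteFractional.bothToInfinity]
        (fun m : ℤ × ℤ => 1 / DiscreteFractional.euclNorm m ^ (2 + 2 * s)) :=
  ⟨fun _ hm => ⟨DiscreteFractional.integrableOn_heatKernel₂_div hs0 hs1 hm,
      DiscreteFractional.fracKernel_pos hs0 hs1 hm⟩,
    (DiscreteFractional.isLittleO_fracKernel_sub hs0 hs1).mono
      DiscreteFractional.tendsto_euclNorm_bothToInfinity.le_comap⟩
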